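/- Let $Q = E_8 \perp U \perp U$ be the even unimodular lattice of signature $(2,10)$ ($E_8$ negative definite, $U$ the hyperbolic plane), with bilinear form $(\cdot,\cdot)$ extended $\mathbb{C}$-bilinearly to $Q \otimes \mathbb{C} \cong \mathbb{C}^{12}$. Let $\mathcal{Q}$ be a connected component of $$\{\Omega \in Q \otimes \mathbb{C} \mid (\Omega,\Omega) = 0,\ (\Omega,\overline{\Omega}) > 0\},$$ and let $\Gamma = O(Q)^+$ be the group of isometries of $Q$ that preserve $\mathcal{Q}$. The group $\mathbb{C}^\times \times \Gamma$ acts on $\mathcal{Q}$ by $(\alpha, g)\cdot z = \alpha\, g z$; let $\mathbf{M} = [\mathcal{Q}/\mathbb{C}^\times \times \Gamma]$ be the quotient orbifold, which has dimension $10$. A line bundle on $\mathbf{M}$ is a $\mathbb{C}^\times \times \Gamma$-equivariant holomorphic line bundle on $\mathcal{Q}$. A character $\chi$ of $\mathbb{C}^\times \times \Gamma$ defines the line bundle $\mathcal{Q} \times \mathbb{C}$ with action $a\cdot(z,v) = (a z, \chi(a) v)$, and the line bundle of the character $(\alpha,g) \mapsto \alpha^{-k} (\det g)^l$ is written $\mathcal{O}_{\mathbf{M}}(k)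 \otimes \det^{k+l}$. In particular $\mathcal{O}_{\mathbf{M}}(10) \otimes \det$ is the line bundle of the character $(\alpha, g) \mapsto \alpha^{-10} \det g$. The canonical bundle $\omega_{\mathbf{M}}$ is the line bundle whose fibre at $z \in \mathcal{Q}$ is the space of alternating $10$-forms on $T_z\mathcal{Q}/\mathbb{C}z$ (the tangent space of $\mathbf{M}$), with the holomorphic structure of differential forms and with $\mathbb{C}^\times \times \Gamma$ acting by transport of forms (pull-back along the inverse). **Proposition.** There is an isomorphism of line bundles on $\mathbf{M}$ $$\omega_{\mathbf{M}} \cong \mathcal{O}_{\mathbf{M}}(10) \otimes \det .$$ -/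

import Mathlib

open scoped Matrix Topology

noncomputable section

namespace PeriodOrbifold

/-! ## The lattice `Q`, its orthogonal group, and the cone `𝒬` -/

/-- The index set of a `ℤ`-basis of the lattice `Q = E₈ ⊥ U ⊥ U`, which has rank 12. -/
abbrev Idx : Type := Fin 8 ⊕ (Fin 2 ⊕ Fin 2)

/-- The Gram matrix of the even unimodular hyperbolic plane `U`. -/
def gramU : Matrix (Fin 2) (Fin 2) ℤ := !![0, 1; 1, 0]

/-- The Gram matrix of `Q = E₈ ⊥ U ⊥ U`, the even unimodular lattice of signature `(2, 10)`.
Here `E₈` is negative definite, so its Gram matrix is minus the Cartan matrix. -/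
def gram : Matrix Idx Idx ℤ :=
  Matrix.fromBlocks (-CartanMatrix.E₈) 0 0 (Matrix.fromBlocks gramU 0 0 gramU)

/-- The complex vector space `Q ⊗ ℂ`, in coordinates with respect to the `ℤ`-basis of `Q`. -/
abbrev V : Type := Idx → ℂ

/-- The `ℂ`-bilinear extension to `Q ⊗ ℂ` of the bilinear form of `Q`. -/
def form : LinearMap.BilinForm ℂ V := Matrix.toBilin' (gram.map (Int.cast : ℤ → ℂ))

/-- The set of `Ω ∈ Q ⊗ ℂ` with `(Ω, Ω) = 0` and `(Ω, Ω̄) > 0`.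
(The number `(Ω, Ω̄)` is always real.) -/
def bothCones : Set V := {z | form z z = 0 ∧ 0 < (form z (star z)).re}

/-- The connected component `𝒬` of `bothCones` that contains the base point `z₀`. -/
def cone (z₀ : V) : Set V := connectedComponentIn bothCones z₀

/-- The `ℂ`-linear extension to `Q ⊗ ℂ` of an automorphism of the `ℤ`-module `Q`. -/
def extend : GL Idx ℤ →* (V →ₗ[ℂ] V) where
  toFun g := Matrix.toLin' ((g : Matrix Idx Idx ℤ).map (Int.castRingHom ℂ))
  map_one' := by simp; rfl
  map_mul' g h := by
    rw [Units.val_mul, Matrix.map_mul, Matrix.toLin'_mul]; rfl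

/-- The group `Γ = O(Q)⁺` of the isometries of the lattice `Q` that preserve
the connected component `𝒬`. -/
def Gam (z₀ : V) : Subgroup (GL Idx ℤ) where
  carrier := {g | (g : Matrix Idx Idx ℤ)ᵀ * gram * (g : Matrix Idx Idx ℤ) = gram ∧
    ∀ z : V, extend g z ∈ cone z₀ ↔ z ∈ cone z₀}
  one_mem' := by simp
  mul_mem' := by
    rintro g h ⟨hg, hg'⟩ ⟨hh, hh'⟩
    refine ⟨?_, fun z => ?_⟩
    · rw [Units.val_mul, Matrix.transpose_mul]
      calc _ = (h : Matrix Idx Idx ℤ)ᵀ * ((g : Matrix Idx Idx ℤ)ᵀ * gram *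
            (g : Matrix Idx Idx ℤ)) * (h : Matrix Idx Idx ℤ) := by
              simp only [Matrix.mul_assoc]
        _ = _ := by rw [hg, hh]
    · rw [map_mul, Module.End.mul_apply, hg', hh']
  inv_mem' := by
    rintro g ⟨hg, hg'⟩
    refine ⟨?_, fun z => ?_⟩
    · have h1 : (g : Matrix Idx Idx ℤ) * ((g⁻¹ : GL Idx ℤ) : Matrix Idx Idx ℤ) = 1 := by
        rw [← Units.val_mul]; simp
      have h2 : ((g⁻¹ : GL Idx ℤ) : Matrix Idx Idx ℤ)ᵀ * (g : Matrix Idx Idx ℤ)ᵀ = 1 := by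
        rw [← Matrix.transpose_mul, h1, Matrix.transpose_one]
      conv_lhs => rw [← hg]
      calc _ = (((g⁻¹ : GL Idx ℤ) : Matrix Idx Idx ℤ)ᵀ * (g : Matrix Idx Idx ℤ)ᵀ) * gram *
            ((g : Matrix Idx Idx ℤ) * ((g⁻¹ : GL Idx ℤ) : Matrix Idx Idx ℤ)) := by
              simp only [Matrix.mul_assoc]
        _ = _ := by rw [h1, h2]; simp
    · rw [← hg', ← Module.End.mul_apply, ← map_mul]; simp

/-- The group `ℂˣ × Γ`. -/
abbrev Grp (z₀ : V) : Type := ℂˣ × Gam z₀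

/-- The linear action of `ℂˣ × Γ` on `Q ⊗ ℂ`: the pair `(α, g)` acts by `v ↦ α • g v`. -/
def lin (z₀ : V) : Grp z₀ →* (V →ₗ[ℂ] V) where
  toFun a := (a.1 : ℂ) • extend (a.2 : GL Idx ℤ)
  map_one' := by simp
  map_mul' a b := by
    ext1 i
    ext j
    simp [mul_smul]
    ring

theorem form_extend {z₀ : V} (g : Gam z₀) (x y : V) :
    form (extend (g : GL Idx ℤ) x) (extend (g : GL Idx ℤ) y) = form x y := by
  have h := congrArg (fun M : Matrix Idx Idx ℤ => M.map (Int.castRingHom ℂ)) g.2.1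
  simp only [Matrix.map_mul, Matrix.transpose_map] at h
  change Matrix.toBilin' _ (Matrix.toLin' _ x) (Matrix.toLin' _ y) = Matrix.toBilin' _ x y
  rw [← LinearMap.BilinForm.comp_apply, Matrix.toBilin'_comp]
  erw [h]
  rfl

theorem form_lin {z₀ : V} (a : Grp z₀) (x y : V) :
    form (lin z₀ a x) (lin z₀ a y) = (a.1 : ℂ) ^ 2 * form x y := by
  change form ((a.1 : ℂ) • extend (a.2 : GL Idx ℤ) x) ((a.1 : ℂ) • extend (a.2 : GL Idx ℤ) y) = _
  simp [form_extend]
  ring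

theorem smul_mem_cone {z₀ z : V} (α : ℂˣ) (hz : z ∈ cone z₀) : (α : ℂ) • z ∈ cone z₀ := by
  have hc : IsConnected ({0}ᶜ : Set ℂ) :=
    isConnected_compl_singleton_of_one_lt_rank (by simp [Complex.rank_real_complex]) 0
  have hcon : IsPreconnected ((fun c : ℂ => c • z) '' ({0}ᶜ : Set ℂ)) :=
    hc.isPreconnected.image _ (by fun_prop)
  have hz' : z ∈ bothCones := connectedComponentIn_subset _ _ hz
  have hsub : (fun c : ℂ => c • z) '' ({0}ᶜ : Set ℂ) ⊆ bothCones := by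
    rintro _ ⟨c, hc0, rfl⟩
    refine ⟨by simp [hz'.1], ?_⟩
    have h1 : form (c • z) (star (c • z)) = (Complex.normSq c : ℂ) * form z (star z) := by
      simp only [star_smul, map_smul, LinearMap.smul_apply, smul_eq_mul, ← Complex.mul_conj]
      simp only [Complex.star_def]
      ring
    change 0 < (form (c • z) (star (c • z))).re
    rw [h1, Complex.re_ofReal_mul]
    exact mul_pos (Complex.normSq_pos.2 hc0) hz'.2
  have hmem : z ∈ (fun c : ℂ => c • z) '' ({0}ᶜ : Set ℂ) := ⟨1, by simp, by simp⟩
  have h := hcon.subset_connectedComponentIn hmem hsub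
  rw [cone, connectedComponentIn_eq hz]
  exact h ⟨α, α.ne_zero, rfl⟩

theorem lin_mem_cone {z₀ z : V} (a : Grp z₀) (hz : z ∈ cone z₀) : lin z₀ a z ∈ cone z₀ :=
  smul_mem_cone a.1 ((a.2.2.2 z).2 hz)

/-- The action of `ℂˣ × Γ` on `𝒬`, whose quotient orbifold is `𝐌 = [𝒬 / ℂˣ × Γ]`. -/
instance (z₀ : V) : MulAction (Grp z₀) (cone z₀) where
  smul a z := ⟨lin z₀ a z, lin_mem_cone a z.2⟩
  one_smul z := Subtype.ext (by change lin z₀ 1 (z : V) = z; simp)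
  mul_smul a b z := Subtype.ext (by
    change lin z₀ (a * b) (z : V) = lin z₀ a (lin z₀ b (z : V)); simp)

theorem coe_smul {z₀ : V} (a : Grp z₀) (z : cone z₀) :
    ((a • z : cone z₀) : V) = lin z₀ a z := rfl

/-! ## Line bundles on `𝐌`: equivariant holomorphic line bundles on `𝒬` -/

/-- A vector valued function on the complex submanifold `𝒬` of `Q ⊗ ℂ` is holomorphic near `z` if,
near `z`, it is the restriction of a holomorphic function on an open subset of `Q ⊗ ℂ`. -/
def HolAt {z₀ : V} {F : Type} [NormedAddCommGroup F] [NormedSpace ℂ F]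
    (f : cone z₀ → F) (z : cone z₀) : Prop :=
  ∃ h : V → F, AnalyticAt ℂ h z ∧ ∀ᶠ y : cone z₀ in 𝓝 z, f y = h y

/-- A family of complex vector spaces over `𝒬` with a fibrewise linear action of `ℂˣ × Γ` that
covers the action on `𝒬`, and with a notion of holomorphic germ of a section. It is an equivariant
holomorphic line bundle, that is a line bundle on `𝐌`, if it satisfies `IsLineBundle` below. -/
structure EquivFamily (z₀ : V) where
  /-- the fibre at a point -/
  Fiber : cone z₀ → Type
  [addCommGroup : ∀ z, AddCommGroup (Fiber z)]
  [module : ∀ z, Module ℂ (Fiber z)]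
  /-- the map from the fibre at `z` to the fibre at `w = a • z` given by `a` -/
  act : ∀ (a : Grp z₀) (z w : cone z₀), a • z = w → (Fiber z →ₗ[ℂ] Fiber w)
  act_one : ∀ z (h : (1 : Grp z₀) • z = z) (v : Fiber z), act 1 z z h v = v
  act_mul : ∀ (a b : Grp z₀) (x y z : cone z₀) (hb : b • x = y) (ha : a • y = z)
    (hab : (a * b) • x = z) (v : Fiber x), act (a * b) x z hab v = act a y z ha (act b x y hb v)
  /-- the section `s` is holomorphic on a neighbourhood of `z` -/
  IsHolAt : (∀ z, Fiber z) → cone z₀ → Prop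
  isHolAt_congr : ∀ (s t : ∀ z, Fiber z) (z : cone z₀), (∀ᶠ y in 𝓝 z, s y = t y) →
    IsHolAt s z → IsHolAt t z

attribute [instance] EquivFamily.addCommGroup EquivFamily.module

namespace EquivFamily

variable {z₀ : V}

/-- `e` is a holomorphic frame of rank one near `z`: at each `y` near `z`, the vector `e y` is a
basis of the fibre, and a section `f • e` is holomorphic if and only if the function `f` is. -/
def IsFrameAt (L : EquivFamily z₀) (e : ∀ z, L.Fiber z) (z : cone z₀) : Prop :=
  ∀ᶠ y in 𝓝 z, Function.Bijective (fun c : ℂ => c • e y) ∧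
    ∀ f : cone z₀ → ℂ, L.IsHolAt (fun x => f x • e x) y ↔ HolAt f y

/-- `L` is a `ℂˣ × Γ`-equivariant holomorphic line bundle: it has a holomorphic frame of rank one
near each point, and in terms of such frames the action of `(α, g)` at `z` is given by a function
that is holomorphic in `(α, z)`. (The group `Γ` is discrete.) -/
def IsLineBundle (L : EquivFamily z₀) : Prop :=
  (∀ z, ∃ e, L.IsFrameAt e z) ∧
  ∀ (α₀ : ℂˣ) (g : Gam z₀) (z : cone z₀), ∃ e e' : ∀ y, L.Fiber y,
    L.IsFrameAt e z ∧ L.IsFrameAt e' ((α₀, g) • z) ∧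
    ∃ h : ℂ × V → ℂ, AnalyticAt ℂ h ((α₀ : ℂ), (z : V)) ∧
      ∀ᶠ p : ℂˣ × cone z₀ in 𝓝 (α₀, z),
        L.act (p.1, g) p.2 ((p.1, g) • p.2) rfl (e p.2) =
          h ((p.1 : ℂ), (p.2 : V)) • e' ((p.1, g) • p.2)

/-- An isomorphism of line bundles on `𝐌`: a fibrewise linear isomorphism over `𝒬` that commutes
with the actions of `ℂˣ × Γ` and is biholomorphic. -/
structure Iso (L M : EquivFamily z₀) where
  /-- the isomorphism of the fibres at `z` -/
  equiv : ∀ z, L.Fiber z ≃ₗ[ℂ] M.Fiber z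
  equivariant : ∀ (a : Grp z₀) (z w : cone z₀) (h : a • z = w) (v : L.Fiber z),
    equiv w (L.act a z w h v) = M.act a z w h (equiv z v)
  holomorphic : ∀ (s : ∀ z, L.Fiber z) (z : cone z₀),
    L.IsHolAt s z ↔ M.IsHolAt (fun y => equiv y (s y)) z

/-- The line bundle on `𝐌` that corresponds to a character `χ` of `ℂˣ × Γ`: the trivial line bundle
`𝒬 × ℂ`, with `a` acting by `(z, v) ↦ (a • z, χ(a) v)`. -/
def ofCharacter (χ : Grp z₀ →* ℂˣ) : EquivFamily z₀ where
  Fiber _ := ℂ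
  act a _ _ _ := LinearMap.mulLeft ℂ (χ a : ℂ)
  act_one z h v := by simp
  act_mul a b x y z _ _ _ v := by simp
  IsHolAt s z := HolAt (F := ℂ) s z
  isHolAt_congr := by
    rintro s t z hst ⟨h, hh, hs⟩
    refine ⟨h, hh, ?_⟩
    filter_upwards [hst, hs] with y h1 h2
    exact h1.symm.trans h2

end EquivFamily

/-- The character `det : Γ → {±1}`, with values in `ℂˣ`. -/
def detChar (z₀ : V) : Gam z₀ →* ℂˣ :=
  (Units.map (Int.castRingHom ℂ).toMonoidHom).comp
    (Matrix.GeneralLinearGroup.det.comp (Gam z₀).subtype)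

/-- The character `(α, g) ↦ α ^ (-k) * (det g) ^ l` of `ℂˣ × Γ`. -/
def character (z₀ : V) (k l : ℤ) : Grp z₀ →* ℂˣ where
  toFun a := a.1 ^ (-k) * detChar z₀ a.2 ^ l
  map_one' := by simp
  map_mul' a b := by
    simp only [Prod.fst_mul, Prod.snd_mul, map_mul, mul_zpow]
    exact mul_mul_mul_comm _ _ _ _

/-- The line bundle `𝒪_𝐌(k) ⊗ det ^ m`. The convention is that the line bundle of the character
`(α, g) ↦ α ^ (-k) * (det g) ^ l` is written as `𝒪_𝐌(k) ⊗ det ^ (k + l)`. -/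
def bundleODet (z₀ : V) (k m : ℤ) : EquivFamily z₀ :=
  EquivFamily.ofCharacter (character z₀ k (m - k))

/-! ## The canonical bundle of `𝐌` -/

section Canonical

variable {z₀ : V}

/-- The tangent space at `z` of the complex manifold `𝒬`, which is cut out by `(z, z) = 0` in an
open subset of `Q ⊗ ℂ`: the kernel of the differential `2 (z, ·)` of the equation. -/
def tangent (z : cone z₀) : Submodule ℂ V := LinearMap.ker (form (z : V))

/-- The tangent space at `z` of the `ℂˣ`-orbit of `z`. -/
def vertical (z : cone z₀) : Submodule ℂ (tangent z) :=
  (Submodule.span ℂ {(z : V)}).comap (tangent z).subtype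

/-- The tangent space of `𝐌` at the image of `z`, which is the tangent space of
`𝒟 = 𝒬 / ℂˣ` at the class of `z`. -/
abbrev TangentM (z : cone z₀) : Type := tangent z ⧸ vertical z

/-- The differential at `z` of the action of `a`, from the tangent space of `𝒬` at `z`
to the one at `w = a • z`. -/
def diffQ (a : Grp z₀) (z w : cone z₀) (h : a • z = w) : tangent z →ₗ[ℂ] tangent w :=
  (lin z₀ a).restrict (by
    intro v hv
    subst h
    have hv' : form (z : V) v = 0 := hv
    change form ((a • z : cone z₀) : V) (lin z₀ a v) = 0
    rw [coe_smul, form_lin, hv', mul_zero])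

/-- The differential of the action of `a` on the tangent spaces of `𝐌`. -/
def diffM (a : Grp z₀) (z w : cone z₀) (h : a • z = w) : TangentM z →ₗ[ℂ] TangentM w :=
  (vertical z).mapQ (vertical w) (diffQ a z w h) (by
    intro v hv
    subst h
    obtain ⟨c, hc⟩ := Submodule.mem_span_singleton.1 (show (v : V) ∈ _ from hv)
    refine Submodule.mem_span_singleton.2 ⟨c, ?_⟩
    change c • ((a • z : cone z₀) : V) = lin z₀ a v
    rw [coe_smul, ← hc, map_smul])

theorem diffM_mk (a : Grp z₀) (z w : cone z₀) (h : a • z = w) (v : tangent z) :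
    diffM a z w h ((vertical z).mkQ v) = (vertical w).mkQ (diffQ a z w h v) := rfl

theorem diffM_one (a : Grp z₀) (ha : a = 1) (z : cone z₀) (h : a • z = z) (v : TangentM z) :
    diffM a z z h v = v := by
  subst ha
  obtain ⟨v, rfl⟩ := Submodule.mkQ_surjective _ v
  rw [diffM_mk]
  congr 1
  apply Subtype.ext
  change lin z₀ 1 (v : V) = v
  simp

theorem diffM_mul (a b : Grp z₀) (x y z : cone z₀) (hb : b • x = y) (ha : a • y = z)
    (hab : (a * b) • x = z) (v : TangentM x) :
    diffM (a * b) x z hab v = diffM a y z ha (diffM b x y hb v) := by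
  obtain ⟨v, rfl⟩ := Submodule.mkQ_surjective _ v
  simp only [diffM_mk]
  congr 1
  apply Subtype.ext
  change lin z₀ (a * b) (v : V) = lin z₀ a (lin z₀ b v)
  simp

/-- The canonical bundle `ω_𝐌`, as an equivariant line bundle on `𝒬`. Its fibre at `z` is the space
of alternating forms of top degree `10 = dim 𝐌` on the tangent space of `𝐌` at the image of `z`;
the group `ℂˣ × Γ` acts by transport of forms, which is pull-back along the inverse;
a section is holomorphic if it has holomorphic values on holomorphic vector fields. -/
def canonicalBundle (z₀ : V) : EquivFamily z₀ where
  Fiber z := TangentM z [⋀^Fin 10]→ₗ[ℂ] ℂ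
  act a z w h :=
    { toFun := fun φ => φ.compLinearMap (diffM a⁻¹ w z (by rw [← h, inv_smul_smul]))
      map_add' := fun _ _ => rfl
      map_smul' := fun _ _ => rfl }
  act_one z h φ := by
    ext v
    change φ (fun i => diffM _ z z _ (v i)) = φ v
    congr 1
    funext i
    exact diffM_one _ inv_one z _ (v i)
  act_mul a b x y z hb ha hab φ := by
    ext v
    change φ (fun i => diffM (a * b)⁻¹ z x _ (v i)) =
      φ (fun i => diffM b⁻¹ y x _ (diffM a⁻¹ z y _ (v i)))
    congr 1
    funext i
    rw [← diffM_mul b⁻¹ a⁻¹ z y x _ _ (by rw [← hab, ← mul_inv_rev, inv_smul_smul])]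
    simp only [mul_inv_rev]
  IsHolAt s z := ∀ v : Fin 10 → ∀ y : cone z₀, tangent y,
    (∀ i, HolAt (fun y => (v i y : V)) z) →
      HolAt (fun y => s y (fun i => (vertical y).mkQ (v i y))) z
  isHolAt_congr := by
    intro s t z hst hs v hv
    obtain ⟨h, hh, hs'⟩ := hs v hv
    refine ⟨h, hh, ?_⟩
    filter_upwards [hst, hs'] with y h1 h2
    rw [← h1]
    exact h2

end Canonical

end PeriodOrbifold

end

noncomputable section

namespace PeriodOrbifold

/-! ## Holomorphic functions on `𝒬` -/

section HolAt

variable {z₀ : V} {z : cone z₀}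

/-! The isomorphism comes from an explicit nowhere vanishing section of `canonicalBundle`. For `z`
in the cone and `w` with `(z, w) ≠ 0`, put `η_z(v) = vol(z, w, v₁, …, v₁₀) / (z, w)` on vectors `vᵢ`
orthogonal to `z`. The numerator is linear in `w` and vanishes for `w ⊥ z`, since `z^⊥` has
dimension 11; hence it is proportional to `(z, w)` and `η_z` does not depend on `w`
(`form_mul_volCons`). Adding multiples of `z` to the `vᵢ` changes nothing, so `η_z` descends to
`TangentM z`; this is `volForm`.

Under `(α, g)` the volume scales by `α ^ 12 * det g` and the form by `α ^ 2`, so `η` scales by `α ^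
10 * det g` (`volForm_diffM`). Transport of forms uses the inverse, and `det g = ±1`, which gives
the character `α ^ (-10) * det g` (`act_volForm`). The freedom in `w` also gives holomorphy: near a
point, `w` may be kept constant (`isHolAt_smul_volForm_iff`). -/

theorem HolAt.congr {F : Type} [NormedAddCommGroup F] [NormedSpace ℂ F] {f g : cone z₀ → F}
    (hf : HolAt f z) (h : ∀ᶠ y in 𝓝 z, f y = g y) : HolAt g z := by
  obtain ⟨k, hk, hfk⟩ := hf
  refine ⟨k, hk, ?_⟩
  filter_upwards [h, hfk] with y h1 h2
  exact h1.symm.trans h2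

theorem holAt_of_analyticAt {F : Type} [NormedAddCommGroup F] [NormedSpace ℂ F] {f : V → F}
    (hf : AnalyticAt ℂ f z) : HolAt (fun y : cone z₀ => f y) z :=
  ⟨f, hf, Filter.Eventually.of_forall fun _ => rfl⟩

theorem HolAt.mul {f g : cone z₀ → ℂ} (hf : HolAt f z) (hg : HolAt g z) :
    HolAt (fun y => f y * g y) z := by
  obtain ⟨h, hh, hfh⟩ := hf
  obtain ⟨k, hk, hgk⟩ := hg
  refine ⟨fun y => h y * k y, hh.mul hk, ?_⟩
  filter_upwards [hfh, hgk] with y h1 h2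
  rw [h1, h2]

theorem HolAt.div {f g : cone z₀ → ℂ} (hf : HolAt f z) (hg : HolAt g z) (hz : g z ≠ 0) :
    HolAt (fun y => f y / g y) z := by
  obtain ⟨h, hh, hfh⟩ := hf
  obtain ⟨k, hk, hgk⟩ := hg
  refine ⟨fun y => h y / k y, hh.div hk (hgk.self_of_nhds ▸ hz), ?_⟩
  filter_upwards [hfh, hgk] with y h1 h2
  rw [h1, h2]

theorem HolAt.eventually_ne_zero {g : cone z₀ → ℂ} (hg : HolAt g z) (hz : g z ≠ 0) :
    ∀ᶠ y in 𝓝 z, g y ≠ 0 := by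
  obtain ⟨k, hk, hgk⟩ := hg
  have h0 : k z ≠ 0 := hgk.self_of_nhds ▸ hz
  have h1 : ∀ᶠ y : cone z₀ in 𝓝 z, k y ≠ 0 :=
    (hk.continuousAt.comp (x := z) continuous_subtype_val.continuousAt).eventually_ne h0
  filter_upwards [hgk, h1] with y h2 h3
  rwa [h2]

theorem analyticAt_form {f g : V → V} {x : V} (hf : AnalyticAt ℂ f x) (hg : AnalyticAt ℂ g x) :
    AnalyticAt ℂ (fun y => form (f y) (g y)) x := by
  have hf' := analyticAt_pi_iff.1 hf
  have hg' := analyticAt_pi_iff.1 hg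
  simp only [form, Matrix.toBilin'_apply]
  exact Finset.analyticAt_fun_sum _ fun i _ => Finset.analyticAt_fun_sum _ fun j _ =>
    ((hf' i).mul analyticAt_const).mul (hg' j)

end HolAt

/-! ## The volume form of `Q ⊗ ℂ` -/

/-- The determinant of twelve vectors of `Q ⊗ ℂ` with respect to the basis of `Q`. -/
def vol : V [⋀^Fin 12]→ₗ[ℂ] ℂ :=
  ((Pi.basisFun ℂ Idx).reindex (Fintype.equivFinOfCardEq (by simp [Idx]))).det

theorem vol_ne_zero {v : Fin 12 → V} (hv : LinearIndependent ℂ v) : vol v ≠ 0 := by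
  have hcard : Fintype.card (Fin 12) = Module.finrank ℂ V := by simp [Idx]
  exact ((Module.Basis.is_basis_iff_det _).1
    ⟨hv, hv.span_eq_top_of_card_eq_finrank' hcard⟩).ne_zero

theorem vol_comp (f : V →ₗ[ℂ] V) (v : Fin 12 → V) :
    vol (fun i => f (v i)) = LinearMap.det f * vol v :=
  Module.Basis.det_comp _ f v

/-- With the vectors as rows of a matrix, the volume is visibly polynomial in the coordinates, and
row operations apply. -/
theorem vol_eq_det (v : Fin 12 → V) :
    vol v = Matrix.det (Matrix.of fun i j : Fin 12 =>
      v i ((Fintype.equivFinOfCardEq (by simp [Idx]) : Idx ≃ Fin 12).symm j)) := by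
  rw [vol, Module.Basis.det_apply, ← Matrix.det_transpose]
  congr 1

/-- Adding multiples of one of the vectors to the others does not change the volume. -/
theorem vol_add_smul (v : Fin 12 → V) (c : Fin 12 → ℂ) (k : Fin 12) (hk : c k = 0) :
    vol (fun i => v i + c i • v k) = vol v := by
  rw [vol_eq_det, vol_eq_det]
  exact Matrix.det_eq_of_forall_row_eq_smul_add_const c k hk fun i j => by simp

theorem holAt_vol {z₀ : V} {z : cone z₀} {v : Fin 12 → cone z₀ → V}
    (hv : ∀ i, HolAt (v i) z) : HolAt (fun y => vol fun i => v i y) z := by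
  choose h hh hv using hv
  refine ⟨fun y => vol fun i => h i y, ?_, ?_⟩
  · simp only [vol_eq_det, Matrix.det_apply, Matrix.of_apply]
    exact Finset.analyticAt_fun_sum _ fun σ _ => AnalyticAt.const_smul
      (Finset.analyticAt_fun_prod _ fun i _ => analyticAt_pi_iff.1 (hh _) _)
  · filter_upwards [Filter.eventually_all.2 hv] with y hy
    simp only [hy]

attribute [irreducible] vol

/-! ## The canonical section of the canonical bundle -/

section Section

variable {z₀ : V}

theorem form_self (z : cone z₀) : form (z : V) z = 0 :=
  (connectedComponentIn_subset _ _ z.2).1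

theorem form_star_ne_zero (z : cone z₀) : form (z : V) (star (z : V)) ≠ 0 := by
  intro h
  have := (connectedComponentIn_subset _ _ z.2).2
  simp [h] at this

theorem coe_ne_zero (z : cone z₀) : (z : V) ≠ 0 := by
  intro h
  exact form_star_ne_zero z (by rw [h]; simp)

theorem finrank_tangent (z : cone z₀) : Module.finrank ℂ (tangent z) = 11 := by
  have hsurj : LinearMap.range (form (z : V)) = ⊤ :=
    LinearMap.range_eq_top.2 (LinearMap.surjective fun h => form_star_ne_zero z (by rw [h]; rfl))
  have h := LinearMap.finrank_range_add_finrank_ker (form (z : V))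
  rw [hsurj, finrank_top] at h
  have hV : Module.finrank ℂ V = 12 := by simp [Idx]
  rw [hV, Module.finrank_self] at h
  change Module.finrank ℂ (LinearMap.ker (form (z : V))) = 11
  omega

theorem vertical_eq (z : cone z₀) :
    vertical z = Submodule.span ℂ {(⟨z, form_self z⟩ : tangent z)} := by
  ext v
  rw [Submodule.mem_span_singleton]
  change (v : V) ∈ Submodule.span ℂ {(z : V)} ↔ _
  rw [Submodule.mem_span_singleton]
  exact exists_congr fun c => ⟨fun h => Subtype.ext h, fun h => congrArg Subtype.val h⟩

theorem finrank_tangentM (z : cone z₀) : Module.finrank ℂ (TangentM z) = 10 := by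
  have h : Module.finrank ℂ (TangentM z) + Module.finrank ℂ (vertical z) =
      Module.finrank ℂ (tangent z) := Submodule.finrank_quotient_add_finrank (vertical z)
  have h1 : Module.finrank ℂ (vertical z) = 1 := by
    rw [vertical_eq]
    exact finrank_span_singleton fun h => coe_ne_zero z (congrArg Subtype.val h)
  rw [finrank_tangent, h1] at h
  omega

/-- The orthogonal complement of `z` has dimension 11, so twelve of its vectors have volume zero. -/
theorem vol_cons_eq_zero (z : cone z₀) {w : V} (hw : form (z : V) w = 0) (v : Fin 10 → tangent z) :
    vol (Matrix.vecCons (z : V) (Matrix.vecCons w fun i => (v i : V))) = 0 := by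
  apply vol.map_linearDependent
  intro h
  have hmem : ∀ i, (Matrix.vecCons (z : V) (Matrix.vecCons w fun i => (v i : V)) : Fin 12 → V) i
      ∈ tangent z := by
    intro i
    refine Fin.cases (form_self z) (fun i => Fin.cases hw (fun i => (v i).2) i) i
  have h' : LinearIndependent ℂ (fun i => (⟨_, hmem i⟩ : tangent z)) :=
    LinearIndependent.of_comp (tangent z).subtype h
  have := h'.fintype_card_le_finrank
  rw [finrank_tangent] at this
  simp at this

/-- The volume, with `z` and `w` as the first two vectors, as a form in the other ten. -/
def volCons (z w : V) : V [⋀^Fin 10]→ₗ[ℂ] ℂ :=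
  AlternatingMap.curryLeft (n := 10) (AlternatingMap.curryLeft (n := 11) vol z) w

theorem volCons_apply (z w : V) (v : Fin 10 → V) :
    volCons z w v = vol (Matrix.vecCons z (Matrix.vecCons w v)) := rfl

/-- The combination `(z, w') w - (z, w) w'` is orthogonal to `z`, so its volume with `z` and the `v
i` vanishes. -/
theorem form_mul_volCons (z : cone z₀) (w w' : V) (v : Fin 10 → tangent z) :
    form (z : V) w' * volCons z w (fun i => v i) = form (z : V) w * volCons z w' (fun i => v i) := by
  have h := vol_cons_eq_zero z (w := form (z : V) w' • w - form (z : V) w • w')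
    (by simp [mul_comm]) v
  rw [← volCons_apply] at h
  have h2 : volCons z (form (z : V) w' • w - form (z : V) w • w') =
      form (z : V) w' • volCons z w - form (z : V) w • volCons z w' :=
    ((AlternatingMap.curryLeftLinearMap (n := 10)
      (AlternatingMap.curryLeft (n := 11) vol (z : V))).map_sub _ _).trans
      (congrArg₂ _ (LinearMap.map_smul _ _ _) (LinearMap.map_smul _ _ _))
  rw [h2] at h
  exact sub_eq_zero.1 h

theorem volCons_add_smul (z w : V) (v : Fin 10 → V) (c : Fin 10 → ℂ) :
    volCons z w (fun i => v i + c i • z) = volCons z w v := by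
  rw [volCons_apply, volCons_apply,
    -- The two leading zero coefficients leave `z` and `w` themselves unchanged.
    ← vol_add_smul (Matrix.vecCons z (Matrix.vecCons w v)) (Matrix.vecCons 0 (Matrix.vecCons 0 c)) 0 rfl]
  congr 1
  funext i
  refine Fin.cases (by simp) (fun i => Fin.cases (by simp) (fun i => by simp) i) i

/-- The nowhere vanishing section of the canonical bundle whose value at `z`, on the vectors `v i`,
is the volume of `z`, `w` and the `v i`, for any `w` with `(z, w) = 1`. -/
def volForm (z : cone z₀) : TangentM z [⋀^Fin 10]→ₗ[ℂ] ℂ :=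
  (form (z : V) (star (z : V)))⁻¹ • (volCons z (star (z : V))).compLinearMap
    ((tangent z).subtype ∘ₗ ((vertical z).mkQ.exists_rightInverse_of_surjective
      (Submodule.range_mkQ _)).choose)

/-- Two lifts of a class differ by a multiple of `z`, which `volCons_add_smul` absorbs; so the
linear section chosen in `volForm` is immaterial. -/
theorem volForm_mk (z : cone z₀) (v : Fin 10 → tangent z) :
    volForm z (fun i => (vertical z).mkQ (v i)) =
      (form (z : V) (star (z : V)))⁻¹ * volCons z (star (z : V)) (fun i => v i) := by
  set S := ((vertical z).mkQ.exists_rightInverse_of_surjective (Submodule.range_mkQ _)).choose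
  have hS' : (vertical z).mkQ ∘ₗ S = LinearMap.id :=
    ((vertical z).mkQ.exists_rightInverse_of_surjective (Submodule.range_mkQ _)).choose_spec
  have hc : ∀ i, ∃ c : ℂ, c • (z : V) = S ((vertical z).mkQ (v i)) - v i := by
    intro i
    have h1 : S ((vertical z).mkQ (v i)) - v i ∈ vertical z := by
      rw [← Submodule.Quotient.eq]
      exact LinearMap.congr_fun hS' ((vertical z).mkQ (v i))
    exact Submodule.mem_span_singleton.1 (show
      ((S ((vertical z).mkQ (v i)) - v i : tangent z) : V) ∈ Submodule.span ℂ {(z : V)} from h1)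
  choose c hc using hc
  rw [← volCons_add_smul (z : V) _ _ c]
  change _ * volCons z (star (z : V)) (fun i => (S ((vertical z).mkQ (v i)) : V)) = _
  congr 2
  funext i
  rw [hc]
  simp

/-- This replaces `star z`, which is not holomorphic in `z`, by any convenient `w`: a constant one
for holomorphy, a transported one for equivariance. -/
theorem form_mul_volForm_mk (z : cone z₀) (w : V) (v : Fin 10 → tangent z) :
    form (z : V) w * volForm z (fun i => (vertical z).mkQ (v i)) = volCons z w (fun i => v i) := by
  rw [volForm_mk, mul_left_comm, ← form_mul_volCons, ← mul_assoc,
    inv_mul_cancel₀ (form_star_ne_zero z), one_mul]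

theorem volForm_ne_zero_of_linearIndependent (z : cone z₀) (v : Fin 10 → tangent z)
    (hv : LinearIndependent ℂ (fun i => (vertical z).mkQ (v i))) :
    volForm z (fun i => (vertical z).mkQ (v i)) ≠ 0 := by
  rw [volForm_mk]
  refine mul_ne_zero (inv_ne_zero (form_star_ne_zero z)) (vol_ne_zero ?_)
  rw [Fintype.linearIndependent_iff]
  intro g hg
  rw [Fin.sum_univ_succ, Fin.sum_univ_succ] at hg
  change g 0 • (z : V) + (g (Fin.succ 0) • star (z : V) +
    ∑ i : Fin 10, g i.succ.succ • (v i : V)) = 0 at hg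
  -- Pairing with `z` kills every term but that of `star z`. The quotient by the line of `z` then
  -- isolates the `v i`, and only `z ≠ 0` remains.
  have h1 : g (Fin.succ 0) = 0 := by
    have := congrArg (form (z : V)) hg
    simp only [map_add, map_smul, map_sum, form_self, map_zero, smul_eq_mul, mul_zero,
      zero_add] at this
    rw [Finset.sum_eq_zero fun i _ => by
      rw [show form (z : V) (v i) = 0 from (v i).2, mul_zero], add_zero] at this
    exact (mul_eq_zero.1 this).resolve_right (form_star_ne_zero z)
  rw [h1, zero_smul, zero_add] at hg
  have h2 : ∀ i : Fin 10, g i.succ.succ = 0 := by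
    refine Fintype.linearIndependent_iff.1 hv (fun i => g i.succ.succ) ?_
    simp only [← map_smul, ← map_sum]
    rw [Submodule.mkQ_apply, Submodule.Quotient.mk_eq_zero]
    refine Submodule.mem_span_singleton.2 ⟨-g 0, ?_⟩
    rw [map_sum, neg_smul, neg_eq_iff_add_eq_zero]
    exact hg
  have h3 : g 0 = 0 := by
    simp only [h2, zero_smul, Finset.sum_const_zero, add_zero] at hg
    exact (smul_eq_zero.1 hg).resolve_right (coe_ne_zero z)
  intro i
  exact Fin.cases h3 (fun i => Fin.cases h1 h2 i) i

theorem exists_basis_lift (z : cone z₀) : ∃ (b : Module.Basis (Fin 10) ℂ (TangentM z))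
    (v : Fin 10 → tangent z), ∀ i, (vertical z).mkQ (v i) = b i := by
  let b := Module.finBasisOfFinrankEq ℂ (TangentM z) (finrank_tangentM z)
  choose v hv using fun i => Submodule.mkQ_surjective (vertical z) (b i)
  exact ⟨b, v, hv⟩

theorem volForm_ne_zero (z : cone z₀) : volForm z ≠ 0 := by
  obtain ⟨b, v, hv⟩ := exists_basis_lift z
  intro h
  refine volForm_ne_zero_of_linearIndependent z v ?_ (by rw [h]; rfl)
  simp only [hv]
  exact b.linearIndependent

theorem bijective_smul_volForm (z : cone z₀) :
    Function.Bijective (fun c : ℂ => c • volForm z) := by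
  refine ⟨smul_left_injective ℂ (volForm_ne_zero z), fun φ => ?_⟩
  obtain ⟨b, -⟩ := exists_basis_lift z
  obtain ⟨k, hk⟩ : ∃ k : ℂ, volForm z = k • b.det := ⟨_, (volForm z).eq_smul_basis_det b⟩
  have hk0 : k ≠ 0 := fun h => volForm_ne_zero z (by rw [hk, h, zero_smul])
  refine ⟨φ b / k, ?_⟩
  change (φ b / k) • volForm z = φ
  rw [hk, smul_smul, div_mul_cancel₀ _ hk0]
  exact (φ.eq_smul_basis_det b).symm

/-- The fibre of the canonical bundle, identified with `ℂ` by means of `volForm`. -/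
def fiberEquiv (z : cone z₀) : ℂ ≃ₗ[ℂ] (TangentM z [⋀^Fin 10]→ₗ[ℂ] ℂ) :=
  LinearEquiv.ofBijective (LinearMap.toSpanSingleton ℂ _ (volForm z)) (bijective_smul_volForm z)

/-! ## The action on the section -/

theorem det_extend (g : Gam z₀) : LinearMap.det (extend (g : GL Idx ℤ)) = (detChar z₀ g : ℂ) := by
  have h1 : extend (g : GL Idx ℤ) = Matrix.toLin' (((g : GL Idx ℤ) : Matrix Idx Idx ℤ).map
    (Int.castRingHom ℂ)) := rfl
  have h2 : (detChar z₀ g : ℂ) =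
    Int.castRingHom ℂ (Matrix.GeneralLinearGroup.det (g : GL Idx ℤ)).val := rfl
  rw [h1, h2, LinearMap.det_toLin', Matrix.GeneralLinearGroup.val_det_apply, RingHom.map_det]
  rfl

theorem det_lin (a : Grp z₀) :
    LinearMap.det (lin z₀ a) = (a.1 : ℂ) ^ 12 * (detChar z₀ a.2 : ℂ) := by
  change LinearMap.det ((a.1 : ℂ) • extend (a.2 : GL Idx ℤ)) = _
  rw [LinearMap.det_smul, det_extend]
  simp [Idx]

theorem detChar_mul_self (g : Gam z₀) : detChar z₀ g * detChar z₀ g = 1 := by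
  change Units.map _ (Matrix.GeneralLinearGroup.det (g : GL Idx ℤ)) *
    Units.map _ (Matrix.GeneralLinearGroup.det (g : GL Idx ℤ)) = 1
  rw [← map_mul, Int.units_mul_self, map_one]

theorem character_apply (a : Grp z₀) :
    (character z₀ 10 (1 - 10) a : ℂ) = ((a.1 : ℂ) ^ 10)⁻¹ * detChar z₀ a.2 := by
  have h : detChar z₀ a.2 ^ (1 - 10 : ℤ) = detChar z₀ a.2 := by
    -- The exponent `-9` is odd and `det` squares to one.
    rw [show (1 - 10 : ℤ) = 1 + 2 * (-5) by norm_num, zpow_add, zpow_mul, zpow_one, zpow_ofNat,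
      pow_two, detChar_mul_self, one_zpow, mul_one]
  change ((a.1 ^ (-10 : ℤ) * detChar z₀ a.2 ^ (1 - 10 : ℤ) : ℂˣ) : ℂ) = _
  rw [h]
  simp [zpow_neg]

theorem volForm_diffM (a : Grp z₀) (z w : cone z₀) (h : a • z = w) (u : Fin 10 → TangentM z) :
    volForm w (fun i => diffM a z w h (u i)) =
      (a.1 : ℂ) ^ 10 * (detChar z₀ a.2 : ℂ) * volForm z u := by
  choose v hv using fun i => Submodule.mkQ_surjective (vertical z) (u i)
  obtain rfl : (fun i => (vertical z).mkQ (v i)) = u := funext hv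
  have ha : (a.1 : ℂ) ≠ 0 := a.1.ne_zero
  have hz := form_star_ne_zero z
  -- With the image of `star z` as auxiliary vector at `w`, all twelve vectors are images under `lin
  -- z₀ a`, so the volume scales by its determinant.
  have h1 := form_mul_volForm_mk w (lin z₀ a (star (z : V))) (fun i => diffQ a z w h (v i))
  have h2 := form_mul_volForm_mk z (star (z : V)) v
  have hw : (w : V) = lin z₀ a z := by rw [← h, coe_smul]
  have h3 : volCons (w : V) (lin z₀ a (star (z : V))) (fun i => (diffQ a z w h (v i) : V)) =
      LinearMap.det (lin z₀ a) * volCons (z : V) (star (z : V)) (fun i => v i) := by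
    rw [volCons_apply, volCons_apply, ← vol_comp, hw]
    congr 1
    funext i
    exact Fin.cases rfl (fun i => Fin.cases rfl (fun i => rfl) i) i
  have h4 : form (w : V) (lin z₀ a (star (z : V))) =
      (a.1 : ℂ) ^ 2 * form (z : V) (star (z : V)) := by
    rw [hw, form_lin]
  rw [h3, h4, ← h2, det_lin] at h1
  have h5 : (a.1 : ℂ) ^ 2 * form (z : V) (star (z : V)) ≠ 0 := mul_ne_zero (pow_ne_zero 2 ha) hz
  apply mul_left_cancel₀ h5
  simp only [diffM_mk]
  rw [h1]
  ring

theorem act_volForm (a : Grp z₀) (z w : cone z₀) (h : a • z = w) :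
    (canonicalBundle z₀).act a z w h (volForm z) =
      (character z₀ 10 (1 - 10) a : ℂ) • volForm w := by
  refine AlternatingMap.ext fun u => ?_
  have h1 := volForm_diffM a⁻¹ w z (by rw [← h, inv_smul_smul]) u
  have h2 : detChar z₀ a⁻¹.2 = detChar z₀ a.2 := by
    rw [Prod.snd_inv, map_inv, inv_eq_iff_mul_eq_one]
    exact detChar_mul_self a.2
  have h3 : (a⁻¹.1 : ℂ) = (a.1 : ℂ)⁻¹ := by simp
  rw [h2, h3, inv_pow] at h1
  rw [character_apply]
  exact h1

/-! ## Holomorphic sections of the canonical bundle -/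

theorem isHolAt_smul_volForm_iff (f : cone z₀ → ℂ) (z : cone z₀) :
    (canonicalBundle z₀).IsHolAt (fun y => f y • volForm y) z ↔ HolAt f z := by
  have hid : AnalyticAt ℂ (fun y : V => y) z := analyticAt_id
  -- The auxiliary vector is frozen at `star z` while `y` varies; its pairing with `y` stays nonzero
  -- near `z`.
  have hw : HolAt (fun y : cone z₀ => form (y : V) (star (z : V))) z :=
    holAt_of_analyticAt (analyticAt_form hid analyticAt_const)
  have hwz : form (z : V) (star (z : V)) ≠ 0 := form_star_ne_zero z
  have key : ∀ v : Fin 10 → ∀ y : cone z₀, tangent y, (∀ i, HolAt (fun y => (v i y : V)) z) →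
      HolAt (fun y => volForm y (fun i => (vertical y).mkQ (v i y))) z := by
    intro v hv
    have h1 : HolAt (fun y : cone z₀ => volCons y (star (z : V)) (fun i => v i y)) z := by
      have := holAt_vol (z := z) (v := Matrix.vecCons (fun y : cone z₀ => (y : V))
        (Matrix.vecCons (fun _ => star (z : V)) fun i y => (v i y : V)))
        (fun i => Fin.cases (holAt_of_analyticAt hid)
          (fun i => Fin.cases (holAt_of_analyticAt analyticAt_const) hv i) i)
      refine this.congr (Filter.Eventually.of_forall fun y => ?_)
      rw [volCons_apply]
      congr 1
      funext i
      exact Fin.cases rfl (fun i => Fin.cases rfl (fun i => rfl) i) i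
    refine (h1.div hw hwz).congr ?_
    filter_upwards [hw.eventually_ne_zero hwz] with y hy
    rw [← form_mul_volForm_mk, mul_div_cancel_left₀ _ hy]
  constructor
  · intro h
    obtain ⟨b, v, hv⟩ := exists_basis_lift z
    -- These fields are holomorphic, tangent at every `y`, and equal to `(z, star z) • v i` at `z`.
    -- Dividing the value of `f • volForm` on them by that of `volForm` recovers `f`.
    let V' : Fin 10 → ∀ y : cone z₀, tangent y := fun i y =>
      ⟨form (y : V) (star (z : V)) • (v i : V) - form (y : V) (v i) • star (z : V), by
        change form (y : V) _ = 0
        simp [mul_comm]⟩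
    have hV' : ∀ i, HolAt (fun y => (V' i y : V)) z := fun i =>
      holAt_of_analyticAt (((analyticAt_form hid analyticAt_const).smul analyticAt_const).sub
        ((analyticAt_form hid analyticAt_const).smul analyticAt_const))
    have hne : volForm z (fun i => (vertical z).mkQ (V' i z)) ≠ 0 := by
      apply volForm_ne_zero_of_linearIndependent
      have h2 : ∀ i, V' i z = form (z : V) (star (z : V)) • v i := by
        intro i
        apply Subtype.ext
        change _ - form (z : V) (v i) • _ = _
        rw [show form (z : V) (v i) = 0 from (v i).2, zero_smul, sub_zero]
        rfl
      simp only [h2, map_smul, hv]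
      exact b.linearIndependent.units_smul (fun _ => Units.mk0 _ hwz)
    have h3 := ((h V' hV').div (key V' hV') hne)
    refine h3.congr ?_
    filter_upwards [(key V' hV').eventually_ne_zero hne] with y hy
    exact mul_div_cancel_right₀ _ hy
  · intro hf v hv
    exact hf.mul (key v hv)

end Section

/-! ### Line bundles of characters, and invariance under isomorphism -/

namespace EquivFamily

variable {z₀ : V}

theorem isFrameAt_one_ofCharacter (χ : Grp z₀ →* ℂˣ) (z : cone z₀) :
    (ofCharacter χ).IsFrameAt (fun _ => (1 : ℂ)) z := by
  refine Filter.Eventually.of_forall fun y => ⟨?_, fun f => ?_⟩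
  · change Function.Bijective (fun c : ℂ => c * 1)
    simpa using! Function.bijective_id
  · change HolAt (fun x => f x * 1) y ↔ HolAt f y
    simp

theorem isLineBundle_bundleODet (k m : ℤ) : (bundleODet z₀ k m).IsLineBundle := by
  refine ⟨fun z => ⟨_, isFrameAt_one_ofCharacter _ z⟩, fun α₀ g z =>
    ⟨_, _, isFrameAt_one_ofCharacter _ z, isFrameAt_one_ofCharacter _ _,
      fun p => p.1 ^ (-k) * (detChar z₀ g ^ (m - k) : ℂˣ), ?_, ?_⟩⟩
  · exact (analyticAt_fst.fun_zpow α₀.ne_zero).mul analyticAt_const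
  · refine Filter.Eventually.of_forall fun p => ?_
    change ((p.1 ^ (-k) * detChar z₀ g ^ (m - k) : ℂˣ) : ℂ) * 1 = (_ * _) * 1
    rw [Units.val_mul, Units.val_zpow_eq_zpow_val]

theorem IsFrameAt.of_iso {L M : EquivFamily z₀} (φ : Iso L M) {e : ∀ z, M.Fiber z} {z : cone z₀}
    (he : M.IsFrameAt e z) : L.IsFrameAt (fun y => (φ.equiv y).symm (e y)) z := by
  filter_upwards [he] with y hy
  refine ⟨?_, fun f => ?_⟩
  · have := (φ.equiv y).symm.bijective.comp hy.1
    simpa [Function.comp_def] using this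
  · rw [φ.holomorphic, ← hy.2 f]
    simp

/-- Frames are pulled back along `φ`, and equivariance keeps the same multiplier `h`. Thus
`canonicalBundle` inherits the property from the bundle of a character. -/
theorem IsLineBundle.of_iso {L M : EquivFamily z₀} (φ : Iso L M) (hM : M.IsLineBundle) :
    L.IsLineBundle := by
  refine ⟨fun z => ?_, fun α₀ g z => ?_⟩
  · obtain ⟨e, he⟩ := hM.1 z
    exact ⟨_, he.of_iso φ⟩
  · obtain ⟨e, e', he, he', h, hh, hact⟩ := hM.2 α₀ g z
    refine ⟨_, _, he.of_iso φ, he'.of_iso φ, h, hh, ?_⟩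
    filter_upwards [hact] with p hp
    apply (φ.equiv _).injective
    rw [φ.equivariant, map_smul]
    simpa using hp

end EquivFamily

/-- The isomorphism `ω_𝐌 ≅ 𝒪_𝐌(10) ⊗ det` that sends `volForm` to the constant section `1`. -/
def canonicalIso (z₀ : V) : EquivFamily.Iso (canonicalBundle z₀) (bundleODet z₀ 10 1) where
  equiv z := (fiberEquiv z).symm
  equivariant a z w h φ := by
    obtain ⟨c, rfl⟩ := (fiberEquiv z).surjective φ
    have h1 : (canonicalBundle z₀).act a z w h (c • volForm z) =
        fiberEquiv w ((character z₀ 10 (1 - 10) a : ℂ) * c) := by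
      refine (LinearMap.map_smul _ _ _).trans ?_
      rw [act_volForm, mul_comm]
      exact smul_smul c (character z₀ 10 (1 - 10) a : ℂ) (volForm w)
    refine ((fiberEquiv w).symm_apply_eq.2 h1).trans ?_
    exact congrArg ((character z₀ 10 (1 - 10) a : ℂ) * ·) ((fiberEquiv z).symm_apply_apply c).symm
  holomorphic s z := by
    have h : (fun y => (fiberEquiv y).symm (s y) • volForm y) = s :=
      funext fun y => (fiberEquiv y).apply_symm_apply (s y)
    have h1 := isHolAt_smul_volForm_iff (fun y => (fiberEquiv y).symm (s y)) z
    rw [h] at h1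
    exact h1

end PeriodOrbifold

end

/-- On the orbifold `𝐌 = [𝒬 / ℂˣ × Γ]`, both `ω_𝐌` and `𝒪_𝐌(10) ⊗ det` are line bundles,
and they are isomorphic. -/
theorem mainTheorem4 (z₀ : PeriodOrbifold.V) (hz₀ : z₀ ∈ PeriodOrbifold.bothCones) :
    (PeriodOrbifold.canonicalBundle z₀).IsLineBundle ∧
    (PeriodOrbifold.bundleODet z₀ 10 1).IsLineBundle ∧
    Nonempty (PeriodOrbifold.EquivFamily.Iso (PeriodOrbifold.canonicalBundle z₀)
      (PeriodOrbifold.bundleODet z₀ 10 1)) := by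
  exact ⟨(PeriodOrbifold.EquivFamily.isLineBundle_bundleODet 10 1).of_iso
    (PeriodOrbifold.canonicalIso z₀),
    PeriodOrbifold.EquivFamily.isLineBundle_bundleODet 10 1,
    ⟨PeriodOrbifold.canonicalIso z₀⟩⟩
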